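/- **Setting.** All Hilbert spaces are finite-dimensional with fixed computational bases. Let $N\ge 1$, $\mathcal N=\{1,\dots,N\}$, let $\mathcal H^P$, $\mathcal H^F$ be Hilbert spaces (global past and future) and, for $k\in\mathcal N$, let $\mathcal H^{A_k^I}$, $\mathcal H^{A_k^O}$ be the input and output spaces of the $k$-th external operation. For $\mathcal K\subseteq\mathcal N$ put $\mathcal H^{A_{\mathcal K}^{IO}}=\bigotimes_{k\in\mathcal K}\mathcal H^{A_k^I}\otimes\mathcal H^{A_k^O}$; juxtaposed superscripts denote tensor products. For $V:\mathcal H^X\to\mathcal H^Y$ the Choi vector is $|V\rangle\rangle=\sum_i|i\rangle\otimes V|i\rangle\in\mathcal H^{XY}$. The link product of $|a\rangle\in\mathcal H^{XY}$ and $|b\rangle\in\mathcal H^{YZ}$ is $|a\rangle*|b\rangle=\sum_i(\mathbb 1^X\otimes\langle i|^Y)|a\rangle\otimes(\langle i|^Y\otimes\mathbb 1^Z)|b\rangle$, and for operators $A\in\mathcal L(\mathcal H^{XY})$, $B\in\mathcal L(\mathcal H^{YZ})$ it is $A*B=\operatorname{Tr}_Y[(A^{T_Y}\otimes\mathbb 1^Z)(\mathbb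 1^X\otimes B)]$. **Circuits.** A *quantum circuit with quantum control of causal order* (QC-QC) consists of ancillary spaces $\mathcal H^{\alpha_1},\dots,\mathcal H^{\alpha_N},\mathcal H^{\alpha_F}$ and operators $V_{\emptyset,\emptyset}^{\to k_1}:\mathcal H^P\to\mathcal H^{A_{k_1}^I\alpha_1}$; $V_{\mathcal K_{n-1},k_n}^{\to k_{n+1}}:\mathcal H^{A_{k_n}^O\alpha_n}\to\mathcal H^{A_{k_{n+1}}^I\alpha_{n+1}}$ for $1\le n\le N-1$, $\mathcal K_{n-1}\subset\mathcal N$ with $|\mathcal K_{n-1}|=n-1$ and distinct $k_n,k_{n+1}\in\mathcal N\setminus\mathcal K_{n-1}$; and $V_{\mathcal N\setminus k_N,k_N}^{\to F}:\mathcal H^{A_{k_N}^O\alpha_N}\to\mathcal H^{F\alpha_F}$, subject to the following trace-preserving (TP) conditions. For $1\le n\le N$, $|\mathcal K_{n-1}|=n-1$ and $k_n\notin\mathcal K_{n-1}$ let $$|w_{(\mathcal K_{n-1},k_n)}\rangle=\sum_{(k_1,\dots,k_{n-1})}|V_{\emptyset,\emptyset}^{\to k_1}\rangle\rangle*|V_{\emptyset,k_1}^{\to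 k_2}\rangle\rangle*\cdots*|V_{\{k_1,\dots,k_{n-2}\},k_{n-1}}^{\to k_n}\rangle\rangle\in\mathcal H^{PA_{\mathcal K_{n-1}}^{IO}A_{k_n}^I\alpha_n},$$ the sum being over all orderings of $\mathcal K_{n-1}$, and let $|w_{(\mathcal N,F)}\rangle\in\mathcal H^{PA_{\mathcal N}^{IO}F\alpha_F}$ be the analogous sum over all orderings $(k_1,\dots,k_N)$ of $\mathcal N$, the last factor being $|V_{\{k_1,\dots,k_{N-1}\},k_N}^{\to F}\rangle\rangle$. Writing $[w]=|w\rangle\langle w|$, the TP conditions are $$\sum_{k_1}\operatorname{Tr}_{A_{k_1}^I\alpha_1}[w_{(\emptyset,k_1)}]=\mathbb 1^P,$$ $$\sum_{k_{n+1}\notin\mathcal K_n}\operatorname{Tr}_{A_{k_{n+1}}^I\alpha_{n+1}}[w_{(\mathcal K_n,k_{n+1})}]=\sum_{k_n\in\mathcal K_n}\operatorname{Tr}_{\alpha_n}[w_{(\mathcal K_n\setminus k_n,k_n)}]\otimes\mathbb 1^{A_{k_n}^O}\quad(1\le n\le N-1,\ |\mathcal K_n|=n),$$ $$\operatorname{Tr}_{F\alpha_F}[w_{(\mathcal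 N,F)}]=\sum_{k_N\in\mathcal N}\operatorname{Tr}_{\alpha_N}[w_{(\mathcal N\setminus k_N,k_N)}]\otimes\mathbb 1^{A_{k_N}^O}.$$ Given external operations (single Kraus operators) $A_k:\mathcal H^{A_k^I}\to\mathcal H^{A_k^O}$, the circuit uses at time slot $n$ a control system with orthonormal basis states $|\mathcal K_{n-1},k_n\rangle$ ($|\mathcal K_{n-1}|=n-1$, $k_n\notin\mathcal K_{n-1}$), the target system being in $\mathcal H^{A_{k_n}^I}$ (before the slot) or $\mathcal H^{A_{k_n}^O}$ (after it) when the control is in that state. It applies in succession $\sum_{k_1}V_{\emptyset,\emptyset}^{\to k_1}\otimes|\emptyset,k_1\rangle$; then, at each time slot $n=1,\dots,N$, $\sum_{\mathcal K_{n-1},k_n}A_{k_n}\otimes\mathbb 1^{\alpha_n}\otimes|\mathcal K_{n-1},k_n\rangle\langle\mathcal K_{n-1},k_n|$; between slots $n$ and $n+1$, $\sum_{\mathcal K_{n-1},k_n,k_{n+1}}V_{\mathcal K_{n-1},k_n}^{\to k_{n+1}}\otimes|\mathcal K_{n-1}\cup k_n,k_{n+1}\rangle\langle\mathcal K_{n-1},k_n|$;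 and finally $\sum_{k_N}V_{\mathcal N\setminus k_N,k_N}^{\to F}\otimes\langle\mathcal N\setminus k_N,k_N|$. The composition is an operator $V_A:\mathcal H^P\to\mathcal H^{F\alpha_F}$. The *process matrix* of the circuit is the Hermitian $W\in\mathcal L(\mathcal H^{PA_{\mathcal N}^{IO}F})$ such that, for all $A_1,\dots,A_N$, $$\operatorname{Tr}_{\alpha_F}|V_A\rangle\rangle\langle\langle V_A|=\big(|A_1\rangle\rangle\langle\langle A_1|\otimes\cdots\otimes|A_N\rangle\rangle\langle\langle A_N|\big)*W .$$ **Proposition 7 (Characterisation of QC-QCs).** A matrix $W\in\mathcal L(\mathcal H^{PA_{\mathcal N}^{IO}F})$ is the process matrix of a quantum circuit with quantum control of causal order if and only if $W$ is positive semidefinite and there exist positive semidefinite matrices $W_{(\mathcal K_{n-1},k_n)}\in\mathcal L(\mathcal H^{PA_{\mathcal K_{n-1}}^{IO}A_{k_n}^I})$, for all strict subsets $\mathcal K_{n-1}\subsetneq\mathcal N$ and all $k_n\in\mathcal N\setminus\mathcal K_{n-1}$, such that $$\sum_{k_1\in\mathcal N}\operatorname{Tr}_{A_{k_1}^I}W_{(\emptyset,k_1)}=\mathbb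 1^P,$$ $$\forall\,\emptyset\subsetneq\mathcal K_n\subsetneq\mathcal N:\quad\sum_{k_{n+1}\in\mathcal N\setminus\mathcal K_n}\operatorname{Tr}_{A_{k_{n+1}}^I}W_{(\mathcal K_n,k_{n+1})}=\sum_{k_n\in\mathcal K_n}W_{(\mathcal K_n\setminus k_n,k_n)}\otimes\mathbb 1^{A_{k_n}^O},$$ $$\operatorname{Tr}_FW=\sum_{k_N\in\mathcal N}W_{(\mathcal N\setminus k_N,k_N)}\otimes\mathbb 1^{A_{k_N}^O}.$$ -/

import Mathlib

open scoped ComplexOrder Kronecker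

noncomputable section

namespace QCQC

/-! Hilbert spaces are finite-dimensional and given by the index types of their computational
bases: a vector of `H^X` is a function `X → ℂ`, an operator is a complex matrix, and
`H^X ⊗ H^Y` is indexed by `X × Y`. -/

section Tensor

variable {X Y : Type*}

/-- The rank-one operator `|v⟩⟨v|`. -/
def ketbra (v : X → ℂ) : Matrix X X ℂ :=
  Matrix.vecMulVec v (star v)

/-- Partial trace over the right tensor factor. -/
def trRight [Fintype Y] (M : Matrix (X × Y) (X × Y) ℂ) : Matrix X X ℂ :=
  Matrix.of fun x x' => ∑ y, M (x, y) (x', y)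

/-- The Choi vector `∑ᵢ |i⟩ ⊗ V|i⟩` of an operator `V : H^X → H^Y`. -/
def choiVec (V : Matrix Y X ℂ) : X × Y → ℂ :=
  fun q => V q.2 q.1

end Tensor

/-! There are `N = m + 1 ≥ 1` external operations, labelled by `Fin (m + 1)`; the `k`-th one has
input space `H^{A_k^I}` indexed by `AI k` and output space `H^{A_k^O}` indexed by `AO k`. -/

variable {m : ℕ}

/-- Basis of `H^{A_K^{IO}} = ⨂_{k ∈ K} H^{A_k^I} ⊗ H^{A_k^O}`. -/
abbrev InOut {m : ℕ} (AI AO : Fin (m + 1) → Type*) (K : Finset (Fin (m + 1))) : Type _ :=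
  ∀ k : K, AI k × AO k

/-- The reordering of tensor factors
`H^{P A_K^{IO}} ≅ H^{P A_{K∖k}^{IO}} ⊗ H^{A_k^I} ⊗ H^{A_k^O}` for `k ∈ K`, on basis labels. -/
def split {P : Type*} {AI AO : Fin (m + 1) → Type*} {K : Finset (Fin (m + 1))} (k : K)
    (q : P × InOut AI AO K) :
    ((P × InOut AI AO (K.erase (k : Fin (m + 1)))) × AI k) × AO k :=
  (((q.1, fun j => q.2 ⟨j, Finset.mem_of_mem_erase j.2⟩), (q.2 k).1), (q.2 k).2)

/-- `M ⊗ 𝟙^{A_k^O}` as an operator on `H^{P A_K^{IO}}`, for `k ∈ K` and `M` an operator on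
`H^{P A_{K∖k}^{IO} A_k^I}`. -/
def tensorId {P : Type*} {AI AO : Fin (m + 1) → Type*} [∀ k, DecidableEq (AO k)]
    {K : Finset (Fin (m + 1))} (k : K)
    (M : Matrix ((P × InOut AI AO (K.erase (k : Fin (m + 1)))) × AI k)
      ((P × InOut AI AO (K.erase (k : Fin (m + 1)))) × AI k) ℂ) :
    Matrix (P × InOut AI AO K) (P × InOut AI AO K) ℂ :=
  (M ⊗ₖ (1 : Matrix (AO k) (AO k) ℂ)).submatrix (split k) (split k)

/-- The link product `(C_1 ⊗ ⋯ ⊗ C_N) * W ∈ L(H^{PF})` of Choi matrices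
`C_k ∈ L(H^{A_k^I A_k^O})` with `W ∈ L(H^{P A_N^{IO} F})`. -/
def plug {P F : Type*} {AI AO : Fin (m + 1) → Type*}
    [∀ k, Fintype (AI k)] [∀ k, Fintype (AO k)]
    (C : ∀ k, Matrix (AI k × AO k) (AI k × AO k) ℂ)
    (W : Matrix ((P × InOut AI AO Finset.univ) × F) ((P × InOut AI AO Finset.univ) × F) ℂ) :
    Matrix (P × F) (P × F) ℂ :=
  Matrix.of fun q q' => ∑ x : InOut AI AO Finset.univ, ∑ x' : InOut AI AO Finset.univ,
    (∏ k, C k (x ⟨k, Finset.mem_univ k⟩) (x' ⟨k, Finset.mem_univ k⟩)) *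
      W ((q.1, x), q.2) ((q'.1, x'), q'.2)

/-- The internal operations of a generalised circuit with coherently controlled order, before
trace preservation is imposed. The ancillary space `H^{α_n}` has dimension `anc n`
(`1 ≤ n ≤ N`) and `H^{α_F}` has dimension `ancF`.
* `first k` is `V_{∅,∅}^{→k} : H^P → H^{A_k^I α_1}`;
* `step n K k k'` is `V_{K,k}^{→k'} : H^{A_k^O α_n} → H^{A_{k'}^I α_{n+1}}`; it matters only for
  `|K| = n - 1`, `k ∉ K` and `k' ∉ K ∪ {k}`;
* `last k` is `V_{𝒩∖k,k}^{→F} : H^{A_k^O α_N} → H^{F α_F}`. -/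
structure Internal (P : Type*) (AI AO : Fin (m + 1) → Type*) (F : Type*) where
  anc : ℕ → ℕ
  ancF : ℕ
  first : ∀ k, Matrix (AI k × Fin (anc 1)) P ℂ
  step : ∀ (n : ℕ) (_ : Finset (Fin (m + 1))) (k k' : Fin (m + 1)),
    Matrix (AI k' × Fin (anc (n + 1))) (AO k × Fin (anc n)) ℂ
  last : ∀ k, Matrix (F × Fin ancF) (AO k × Fin (anc (m + 1))) ℂ

namespace Internal

variable {P F : Type*} {AI AO : Fin (m + 1) → Type*}

section Vectors

variable (C : Internal P AI AO F)

/-- The link product of Choi vectors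
`|w_{(k_1,…,k_n,k)}⟩ = |V_{∅,∅}^{→k_1}⟩⟩ * |V_{∅,k_1}^{→k_2}⟩⟩ * ⋯ * |V_{{k_1,…,k_{n-1}},k_n}^{→k}⟩⟩`
in `H^P ⊗ (⨂_i H^{A_{k_i}^{IO}}) ⊗ H^{A_k^I} ⊗ H^{α_{n+1}}`, where `k_i = s (i - 1)`, and `x` lists
the basis labels of the spaces `H^{A_{k_i}^{IO}}`. -/
def wSeq : (n : ℕ) → (s : Fin n → Fin (m + 1)) → (x : ∀ i, AI (s i) × AO (s i)) → P →
    (k : Fin (m + 1)) → AI k → Fin (C.anc (n + 1)) → ℂ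
  | 0, _, _, p, k, i, a => choiVec (C.first k) (p, (i, a))
  | n + 1, s, x, p, k, i, a => ∑ b : Fin (C.anc (n + 1)),
      wSeq n (fun j => s j.castSucc) (fun j => x j.castSucc) p
          (s (Fin.last n)) (x (Fin.last n)).1 b *
        choiVec
          (C.step (n + 1) (Finset.univ.image fun j : Fin n => s j.castSucc) (s (Fin.last n)) k)
          (((x (Fin.last n)).2, b), (i, a))

/-- `|w_{(K,k)}⟩ ∈ H^{P A_K^{IO} A_k^I α_{n+1}}` for `|K| = n`: the sum of the vectors
`|w_{(k_1,…,k_n,k)}⟩` over all orderings `(k_1,…,k_n)` of `K`. -/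
def w (n : ℕ) (K : Finset (Fin (m + 1))) (k : Fin (m + 1)) :
    ((P × InOut AI AO K) × AI k) × Fin (C.anc (n + 1)) → ℂ :=
  fun q => ∑ s : Fin n ≃ K,
    C.wSeq n (fun j => s j) (fun j => q.1.1.2 (s j)) q.1.1.1 k q.1.2 q.2

/-- `|w_{(𝒩,F)}⟩ ∈ H^{P A_𝒩^{IO} F α_F}`: the sum over all orders `(k_1,…,k_N)` of
`|w_{(k_1,…,k_N)}⟩ * |V_{{k_1,…,k_{N-1}},k_N}^{→F}⟩⟩`. -/
def wF : ((P × InOut AI AO Finset.univ) × F) × Fin C.ancF → ℂ :=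
  fun q => ∑ s : Fin (m + 1) ≃ (Finset.univ : Finset (Fin (m + 1))),
    ∑ b : Fin (C.anc (m + 1)),
      C.wSeq m (fun j => s j.castSucc) (fun j => q.1.1.2 (s j.castSucc)) q.1.1.1
          (s (Fin.last m)) (q.1.1.2 (s (Fin.last m))).1 b *
        choiVec (C.last (s (Fin.last m))) (((q.1.1.2 (s (Fin.last m))).2, b), (q.1.2, q.2))

end Vectors

/-- The trace-preserving conditions: every internal operation of the circuit, including the action
on the control system, is an isometry on its effective input space. In the first condition
`H^{P A_∅^{IO}}` is `H^P`. -/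
structure IsTP [DecidableEq P] [Fintype F] [∀ k, Fintype (AI k)] [∀ k, DecidableEq (AI k)]
    [∀ k, DecidableEq (AO k)] (C : Internal P AI AO F) : Prop where
  first : ∑ k, trRight (trRight (ketbra (C.w 0 ∅ k))) = 1
  step : ∀ (n : ℕ) (K : Finset (Fin (m + 1))), n < m → K.card = n + 1 →
    ∑ k ∈ Kᶜ, trRight (trRight (ketbra (C.w (n + 1) K k))) =
      ∑ k : K, tensorId k (trRight (ketbra (C.w n (K.erase (k : Fin (m + 1))) k)))
  last : trRight (trRight (ketbra C.wF)) =
    ∑ k : (Finset.univ : Finset (Fin (m + 1))),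
      tensorId k (trRight (ketbra (C.w m (Finset.univ.erase (k : Fin (m + 1))) k)))

/-! ### The map induced by the circuit

At the `(n+1)`-th time slot the control system has the basis states `|K, k⟩` with `|K| = n` and
`k ∉ K`. The joint space of the target, ancillary and control systems just before (after) the slot
is the orthogonal sum over `(K, k)` of `H^{A_k^I α_{n+1}}` (of `H^{A_k^O α_{n+1}}`); when all `AI k`
coincide and all `AO k` coincide, this is the tensor product of target, ancilla and control. -/

/-- Basis states `|K, k⟩` of the control system at the `(n+1)`-th time slot. -/
abbrev Ctl (m n : ℕ) : Type :=
  {c : Finset (Fin (m + 1)) × Fin (m + 1) // c.1.card = n ∧ c.2 ∉ c.1}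

/-- Target, ancilla and control just before the `(n+1)`-th time slot. -/
abbrev Pre (C : Internal P AI AO F) (n : ℕ) : Type _ :=
  Σ c : Ctl m n, AI c.1.2 × Fin (C.anc (n + 1))

/-- Target, ancilla and control just after the `(n+1)`-th time slot. -/
abbrev Post (C : Internal P AI AO F) (n : ℕ) : Type _ :=
  Σ c : Ctl m n, AO c.1.2 × Fin (C.anc (n + 1))

section Circuit

variable (C : Internal P AI AO F)

/-- `∑_k V_{∅,∅}^{→k} ⊗ |∅,k⟩`. -/
def firstOp : Matrix (C.Pre 0) P ℂ :=
  Matrix.of fun r p => C.first r.1.1.2 r.2 p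

/-- `∑_{K,k,k'} V_{K,k}^{→k'} ⊗ |K ∪ k, k'⟩⟨K, k|`, applied between the time slots
`n + 1` and `n + 2`. -/
def stepOp (n : ℕ) : Matrix (C.Pre (n + 1)) (C.Post n) ℂ :=
  Matrix.of fun r q =>
    if r.1.1.1 = insert q.1.1.2 q.1.1.1 then
      C.step (n + 1) q.1.1.1 q.1.1.2 r.1.1.2 r.2 q.2
    else 0

/-- `∑_k V_{𝒩∖k,k}^{→F} ⊗ ⟨𝒩∖k, k|`. -/
def lastOp : Matrix (F × Fin C.ancF) (C.Post m) ℂ :=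
  Matrix.of fun r q => C.last q.1.1.2 r q.2

/-- `∑_{K,k} A_k ⊗ 𝟙 ⊗ |K,k⟩⟨K,k|`: the external operations applied at the `(n+1)`-th time slot. -/
def extOp (A : ∀ k, Matrix (AO k) (AI k) ℂ) (n : ℕ) : Matrix (C.Post n) (C.Pre n) ℂ :=
  Matrix.blockDiagonal' fun c : Ctl m n =>
    A c.1.2 ⊗ₖ (1 : Matrix (Fin (C.anc (n + 1))) (Fin (C.anc (n + 1))) ℂ)

variable [∀ k, Fintype (AI k)] [∀ k, Fintype (AO k)]

/-- The operator applied by the circuit up to just before the `(n+1)`-th time slot. -/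
def evol (A : ∀ k, Matrix (AO k) (AI k) ℂ) : (n : ℕ) → Matrix (C.Pre n) P ℂ
  | 0 => C.firstOp
  | n + 1 => C.stepOp n * (C.extOp A n * evol A n)

/-- The global operator `H^P → H^{F α_F}` of the circuit with external operations `A_k`. -/
def globalOp (A : ∀ k, Matrix (AO k) (AI k) ℂ) : Matrix (F × Fin C.ancF) P ℂ :=
  C.lastOp * (C.extOp A m * C.evol A m)

/-- The Choi matrix of the map from `L(H^P)` to `L(H^F)` induced by the circuit, `α_F` being
discarded. -/
def inducedChoi (A : ∀ k, Matrix (AO k) (AI k) ℂ) : Matrix (P × F) (P × F) ℂ :=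
  trRight (ketbra fun q : (P × F) × Fin C.ancF => choiVec (C.globalOp A) (q.1.1, (q.1.2, q.2)))

/-- `W` is the process matrix of the circuit: it is Hermitian, and for all external operations `A_k`
the induced map has the Choi matrix `(|A_1⟩⟩⟨⟨A_1| ⊗ ⋯ ⊗ |A_N⟩⟩⟨⟨A_N|) * W`. -/
def HasProcessMatrix
    (W : Matrix ((P × InOut AI AO Finset.univ) × F) ((P × InOut AI AO Finset.univ) × F) ℂ) : Prop :=
  W.IsHermitian ∧ ∀ A : ∀ k, Matrix (AO k) (AI k) ℂ,
    C.inducedChoi A = plug (fun k => ketbra (choiVec (A k))) W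

end Circuit

end Internal

/-- `W` is the process matrix of a quantum circuit with quantum control of causal order. -/
def IsProcessMatrixOfQCQC {P F : Type*} {AI AO : Fin (m + 1) → Type*}
    [DecidableEq P] [Fintype F] [∀ k, Fintype (AI k)] [∀ k, DecidableEq (AI k)]
    [∀ k, Fintype (AO k)] [∀ k, DecidableEq (AO k)]
    (W : Matrix ((P × InOut AI AO Finset.univ) × F) ((P × InOut AI AO Finset.univ) × F) ℂ) : Prop :=
  ∃ C : Internal P AI AO F, C.IsTP ∧ C.HasProcessMatrix W

end QCQC

end

/-!
The process matrix of a circuit is `W = Tr_{α_F} |w_F⟩⟨w_F|`: the operator applied by the circuit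
is the link product of the `|A_k⟩⟩` with `|w_F⟩`, and a matrix is determined by its link products
with the matrices `|A_k⟩⟩⟨⟨A_k|`, since these span and the link product is multilinear. The TP
conditions are then the constraints on `W` and on the matrices `Tr_α |w_{(K,k)}⟩⟨w_{(K,k)}|`.

Conversely, write `W_{(K,k)} = B_{(K,k)} B_{(K,k)}†` with a common ancillary space. The constraint
for `K` equates the Gram operators of two families: the `B_{(K,k')}`, with `A_{k'}^I` moved to the
input side, and the `B_{(K∖k,k)} ⊗ 𝟙^{A_k^O}`. Families with equal Gram operators have the same
range and so are related by operators on the purifying spaces. These serve as the internal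
operations, and by induction on `|K|` the circuit built from them has amplitudes `B_{(K,k)}`.
-/

namespace QCQC

section LinearAlgebra

open Matrix

section Sigma

variable {ι α R T : Type*} {S : ι → Type*} [Fintype ι] [∀ i, Fintype (S i)]
  [NonUnitalNonAssocSemiring α]

theorem mul_eq_sum_submatrix_sigmaMk (M : Matrix R (Σ i, S i) α) (N : Matrix (Σ i, S i) T α) :
    M * N = ∑ i, M.submatrix id (Sigma.mk i) * N.submatrix (Sigma.mk i) id := by
  ext r t
  simp only [mul_apply, Fintype.sum_sigma, Matrix.sum_apply, submatrix_apply, id_eq]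

theorem blockDiagonal'_mul_submatrix_sigmaMk [DecidableEq ι] {Q : ι → Type*}
    (D : ∀ i, Matrix (Q i) (S i) α) (N : Matrix (Σ i, S i) T α) (i : ι) :
    (blockDiagonal' D * N).submatrix (Sigma.mk i) id = D i * N.submatrix (Sigma.mk i) id := by
  ext q t
  simp only [submatrix_apply, id_eq, mul_apply, Fintype.sum_sigma]
  rw [Fintype.sum_eq_single i fun j hj => Finset.sum_eq_zero fun s _ => by
    rw [blockDiagonal'_apply_ne _ _ _ hj.symm, zero_mul]]
  simp only [blockDiagonal'_apply_eq]

end Sigma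

section Purification

variable {𝕜 R S T : Type*} [Field 𝕜] [PartialOrder 𝕜] [StarRing 𝕜] [StarOrderedRing 𝕜]

theorem range_mulVecLin_mul_conjTranspose [Fintype R] [Fintype S] (U : Matrix R S 𝕜) :
    LinearMap.range (U * Uᴴ).mulVecLin = LinearMap.range U.mulVecLin := by
  apply Submodule.eq_of_le_of_finrank_eq
  · rw [mulVecLin_mul]
    exact LinearMap.range_comp_le_range _ _
  · exact rank_self_mul_conjTranspose U

theorem exists_eq_mul_of_mul_conjTranspose_eq [Finite R] [Fintype S] [Fintype T]
    {U : Matrix R S 𝕜} {X : Matrix R T 𝕜} (h : X * Xᴴ = U * Uᴴ) :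
    ∃ V : Matrix S T 𝕜, X = U * V := by
  classical
  have := Fintype.ofFinite R
  have hcol (t : T) : X.col t ∈ LinearMap.range U.mulVecLin := by
    rw [← range_mulVecLin_mul_conjTranspose, ← h, range_mulVecLin_mul_conjTranspose]
    exact ⟨Pi.single t 1, by simp⟩
  choose v hv using hcol
  exact ⟨of fun s t => v t s, by ext r t; exact (congrFun (hv t) r).symm⟩

theorem exists_eq_sum_mul_of_sum_mul_conjTranspose_eq [Finite R] {ι κ : Type*} [Fintype ι]
    [Fintype κ] {S : ι → Type*} {T : κ → Type*} [∀ i, Fintype (S i)] [∀ j, Fintype (T j)]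
    {U : ∀ i, Matrix R (S i) 𝕜} {X : ∀ j, Matrix R (T j) 𝕜}
    (h : ∑ j, X j * (X j)ᴴ = ∑ i, U i * (U i)ᴴ) :
    ∃ V : ∀ i j, Matrix (S i) (T j) 𝕜, ∀ j, X j = ∑ i, U i * V i j := by
  let U' : Matrix R (Σ i, S i) 𝕜 := of fun r s => U s.1 r s.2
  let X' : Matrix R (Σ j, T j) 𝕜 := of fun r t => X t.1 r t.2
  have hgram : X' * X'ᴴ = U' * U'ᴴ := by
    rw [mul_eq_sum_submatrix_sigmaMk X', mul_eq_sum_submatrix_sigmaMk U']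
    exact h
  obtain ⟨V, hV⟩ := exists_eq_mul_of_mul_conjTranspose_eq hgram
  refine ⟨fun i j => V.submatrix (Sigma.mk i) (Sigma.mk j), fun j => ?_⟩
  rw [mul_eq_sum_submatrix_sigmaMk U'] at hV
  ext r t
  rw [Matrix.sum_apply]
  exact (congrFun₂ hV r ⟨j, t⟩).trans (Matrix.sum_apply _ _ _ _)

end Purification

section RCLike

variable {𝕜 R : Type*} [RCLike 𝕜] [Fintype R]

open scoped MatrixOrder in
theorem exists_mul_conjTranspose_eq {A : Matrix R R 𝕜} (hA : A.PosSemidef) {S : Type*}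
    [Fintype S] (hRS : Fintype.card R ≤ Fintype.card S) : ∃ B : Matrix R S 𝕜, B * Bᴴ = A := by
  classical
  obtain ⟨B₀, rfl⟩ := CStarAlgebra.nonneg_iff_eq_star_mul_self.mp hA.nonneg
  obtain ⟨f⟩ := Function.Embedding.nonempty_of_card_le hRS
  let E : Matrix R S 𝕜 := (1 : Matrix S S 𝕜).submatrix f id
  have hE : E * Eᴴ = 1 := by
    rw [conjTranspose_submatrix, conjTranspose_one,
      ← submatrix_mul _ _ f id f Function.bijective_id, Matrix.one_mul, submatrix_one_embedding]
  exact ⟨B₀ᴴ * E, by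
    rw [conjTranspose_mul, conjTranspose_conjTranspose, Matrix.mul_assoc, ← Matrix.mul_assoc E,
      hE, Matrix.one_mul, star_eq_conjTranspose]⟩

theorem exists_forall_mul_conjTranspose_eq {ι : Type*} [Finite ι] {R : ι → Type*}
    [∀ i, Finite (R i)] {A : ∀ i, Matrix (R i) (R i) 𝕜} (hA : ∀ i, (A i).PosSemidef) :
    ∃ (d : ℕ) (B : ∀ i, Matrix (R i) (Fin d) 𝕜), ∀ i, B i * (B i)ᴴ = A i := by
  have := fun i => Fintype.ofFinite (R i)
  obtain ⟨d, hd⟩ := Finite.bddAbove_range fun i => Fintype.card (R i)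
  choose B hB using fun i => exists_mul_conjTranspose_eq (hA i) (S := Fin d)
    (by simpa using hd ⟨i, rfl⟩)
  exact ⟨d, B, hB⟩

end RCLike

section RankOne

variable {X Y : Type*}

theorem vecMulVec_star_polarization (u v : X → ℂ) :
    vecMulVec u (star v) = (1 / 4 : ℂ) • (ketbra (u + v) - ketbra (u - v) +
      Complex.I • ketbra (u + Complex.I • v) - Complex.I • ketbra (u - Complex.I • v)) := by
  ext i j
  simp only [ketbra, vecMulVec_apply, Matrix.smul_apply, Matrix.sub_apply, Matrix.add_apply,
    Pi.star_apply, Pi.add_apply, Pi.sub_apply, Pi.smul_apply, smul_eq_mul, star_add, star_sub,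
    star_mul', RCLike.star_def, Complex.conj_I]
  linear_combination 1 / 2 * (u i * starRingEnd ℂ (v j) - v i * starRingEnd ℂ (u j)) *
    Complex.I_mul_I

theorem span_range_ketbra [Finite X] :
    Submodule.span ℂ (Set.range (ketbra (X := X))) = ⊤ := by
  classical
  have := Fintype.ofFinite X
  have hmem (w : X → ℂ) : ketbra w ∈ Submodule.span ℂ (Set.range (ketbra (X := X))) :=
    Submodule.subset_span ⟨w, rfl⟩
  have hrank (u v : X → ℂ) :
      vecMulVec u (star v) ∈ Submodule.span ℂ (Set.range (ketbra (X := X))) := by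
    rw [vecMulVec_star_polarization]
    exact Submodule.smul_mem _ _ (sub_mem (add_mem (sub_mem (hmem _) (hmem _))
      (Submodule.smul_mem _ _ (hmem _))) (Submodule.smul_mem _ _ (hmem _)))
  refine Submodule.eq_top_iff'.mpr fun M => ?_
  rw [matrix_eq_sum_single M]
  refine sum_mem fun i _ => sum_mem fun j _ => ?_
  rw [← mul_one (M i j), ← smul_eq_mul, ← smul_single, single_eq_single_vecMulVec_single]
  refine Submodule.smul_mem _ _ ?_
  simpa only [← Pi.single_star, star_one] using hrank (Pi.single i 1) (Pi.single j 1)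

end RankOne

theorem multilinearMap_ext_of_span {ι K N : Type*} [Finite ι] [Field K] {M : ι → Type*}
    [∀ i, AddCommGroup (M i)] [∀ i, Module K (M i)] [AddCommGroup N] [Module K N]
    {f g : MultilinearMap K M N} {s : ∀ i, Set (M i)} (hs : ∀ i, Submodule.span K (s i) = ⊤)
    (h : ∀ x : ∀ i, M i, (∀ i, x i ∈ s i) → f x = g x) : f = g :=
  Module.Basis.ext_multilinear (fun i => Module.Basis.ofSpan (hs i).ge) fun _ =>
    h _ fun i => Module.Basis.ofSpan_subset (hs i).ge ⟨_, rfl⟩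

end LinearAlgebra

section Vectorization

open Matrix

variable {X Y Z : Type*}

/-- The vector `v ∈ H^{XY}` as an operator `H^Y → H^X`, with entries in the same bases. -/
def unvec (v : X × Y → ℂ) : Matrix X Y ℂ :=
  of (Function.curry v)

/-- The operator `B : H^Z → H^{XY}` as an operator `H^{YZ} → H^X`: the output leg `Y` is turned
into an input leg. -/
def bendRight (B : Matrix (X × Y) Z ℂ) : Matrix X (Y × Z) ℂ :=
  of fun x q => B (x, q.1) q.2

theorem bendRight_injective :
    Function.Injective (bendRight : Matrix (X × Y) Z ℂ → Matrix X (Y × Z) ℂ) := fun B B' h => by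
  ext ⟨x, y⟩ z
  exact congrFun₂ h x (y, z)

theorem trRight_ketbra [Fintype Y] (v : X × Y → ℂ) :
    trRight (ketbra v) = unvec v * (unvec v)ᴴ :=
  rfl

theorem posSemidef_trRight_ketbra [Finite X] [Fintype Y] (v : X × Y → ℂ) :
    (trRight (ketbra v)).PosSemidef := by
  rw [trRight_ketbra]
  exact posSemidef_self_mul_conjTranspose _

theorem trRight_mul_conjTranspose [Fintype Y] [Fintype Z] (B : Matrix (X × Y) Z ℂ) :
    trRight (B * Bᴴ) = bendRight B * (bendRight B)ᴴ := by
  ext x x'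
  simp only [trRight, bendRight, mul_apply, conjTranspose_apply, of_apply, Fintype.sum_prod_type]

end Vectorization

section Plug

open Matrix

variable {m : ℕ} {P F : Type*} {AI AO : Fin (m + 1) → Type*}
  [∀ k, Fintype (AI k)] [∀ k, Fintype (AO k)]

/-- An entry of the link product `(C_1 ⊗ ⋯ ⊗ C_N) * W`, as a multilinear map in the `C_k`. -/
def plugMultilinear
    (W : Matrix ((P × InOut AI AO Finset.univ) × F) ((P × InOut AI AO Finset.univ) × F) ℂ)
    (q q' : P × F) :
    MultilinearMap ℂ (fun k : Fin (m + 1) => Matrix (AI k × AO k) (AI k × AO k) ℂ) ℂ :=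
  ∑ x : InOut AI AO Finset.univ, ∑ x' : InOut AI AO Finset.univ,
    W ((q.1, x), q.2) ((q'.1, x'), q'.2) •
      (MultilinearMap.mkPiAlgebra ℂ (Fin (m + 1)) ℂ).compLinearMap fun k =>
        entryLinearMap ℂ ℂ (x ⟨k, Finset.mem_univ k⟩) (x' ⟨k, Finset.mem_univ k⟩)

theorem plugMultilinear_apply
    (W : Matrix ((P × InOut AI AO Finset.univ) × F) ((P × InOut AI AO Finset.univ) × F) ℂ)
    (q q' : P × F) (C : ∀ k, Matrix (AI k × AO k) (AI k × AO k) ℂ) :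
    plugMultilinear W q q' C = plug C W q q' := by
  simp [plugMultilinear, plug, mul_comm]

theorem plug_single [∀ k, DecidableEq (AI k)] [∀ k, DecidableEq (AO k)]
    (W : Matrix ((P × InOut AI AO Finset.univ) × F) ((P × InOut AI AO Finset.univ) × F) ℂ)
    (q q' : P × F) (y y' : InOut AI AO Finset.univ) :
    plug (fun k => single (y ⟨k, Finset.mem_univ k⟩) (y' ⟨k, Finset.mem_univ k⟩) (1 : ℂ)) W
      q q' = W ((q.1, y), q.2) ((q'.1, y'), q'.2) := by
  have hprod (x x' : InOut AI AO Finset.univ) :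
      ∏ k, single (y ⟨k, Finset.mem_univ k⟩) (y' ⟨k, Finset.mem_univ k⟩) (1 : ℂ)
        (x ⟨k, Finset.mem_univ k⟩) (x' ⟨k, Finset.mem_univ k⟩) =
      if y = x ∧ y' = x' then 1 else 0 := by
    simp only [single_apply, Fintype.prod_ite_zero, Finset.prod_const_one, funext_iff,
      Subtype.forall, Finset.mem_univ, forall_true_left, forall_and]
  simp [plug, hprod, ite_and]

/-- By multilinearity it suffices to link with rank-one operators `|v_k⟩⟨v_k|`, since these span,
and every `v_k` is the Choi vector of some `A_k`. -/
theorem eq_of_forall_plug_ketbra_choiVec_eq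
    {W W' : Matrix ((P × InOut AI AO Finset.univ) × F) ((P × InOut AI AO Finset.univ) × F) ℂ}
    (h : ∀ A : ∀ k, Matrix (AO k) (AI k) ℂ,
      plug (fun k => ketbra (choiVec (A k))) W = plug (fun k => ketbra (choiVec (A k))) W') :
    W = W' := by
  classical
  have hmultilinear (q q' : P × F) : plugMultilinear W q q' = plugMultilinear W' q q' := by
    refine multilinearMap_ext_of_span (fun k => span_range_ketbra) fun C hC => ?_
    choose v hv using hC
    obtain rfl : (fun k => ketbra (v k)) = C := funext hv
    rw [plugMultilinear_apply, plugMultilinear_apply]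
    exact congrFun₂ (h fun k => of fun o i => v k (i, o)) q q'
  ext ⟨⟨p, y⟩, f⟩ ⟨⟨p', y'⟩, f'⟩
  rw [← plug_single W (p, f) (p', f') y y', ← plug_single W' (p, f) (p', f') y y',
    ← plugMultilinear_apply, hmultilinear, plugMultilinear_apply]

end Plug

section Erase

variable {α : Type*} [DecidableEq α] {K : Finset α}

theorem card_erase_coe {n : ℕ} (hK : K.card = n + 1) (k : K) : (K.erase (k : α)).card = n := by
  rw [Finset.card_erase_of_mem k.2, hK, Nat.add_sub_cancel]

/-- The two encodings of `K ∖ k`, as a subtype of `K` and as a finset, identified. -/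
def subtypeNeEquivErase (k : K) : {j : K // j ≠ k} ≃ K.erase (k : α) where
  toFun j := ⟨j, Finset.mem_erase.mpr ⟨Subtype.coe_ne_coe.mpr j.2, j.1.2⟩⟩
  invFun j := ⟨⟨j, Finset.mem_of_mem_erase j.2⟩,
    fun h => Finset.ne_of_mem_erase j.2 (congrArg Subtype.val h)⟩

theorem prod_eq_mul_prod_erase {M : Type*} [CommMonoid M] (k : K) (a : K → M) :
    ∏ j, a j = a k * ∏ j : K.erase (k : α), a ⟨j, Finset.mem_of_mem_erase j.2⟩ := by
  rw [Fintype.prod_eq_mul_prod_subtype_ne a k]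
  exact congrArg _ (Fintype.prod_equiv (subtypeNeEquivErase k) _ _ fun _ => rfl)

/-- An enumeration of `β` is a last element together with an enumeration of the others. -/
theorem sum_equiv_fin_succ {β M : Type*} [Fintype β] [DecidableEq β] [AddCommMonoid M] {n : ℕ}
    (g : (Fin n → β) → β → M) :
    ∑ s : Fin (n + 1) ≃ β, g (fun j => s j.castSucc) (s (Fin.last n)) =
      ∑ k, ∑ t : Fin n ≃ {j // j ≠ k}, g (fun j => t j) k := by
  rw [← (finSuccEquivLast.symm.equivCongr (Equiv.refl β)).sum_comp,
    ← (Equiv.sigmaFiberEquiv fun e : Option (Fin n) ≃ β => e none).sum_comp, Fintype.sum_sigma]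
  refine Finset.sum_congr rfl fun k _ => ?_
  rw [← (Equiv.optionSubtype k).symm.sum_comp]
  simp

theorem sum_orderings_succ {M : Type*} [AddCommMonoid M] {n : ℕ} (g : (Fin n → K) → K → M) :
    ∑ s : Fin (n + 1) ≃ K, g (fun j => s j.castSucc) (s (Fin.last n)) =
      ∑ k : K, ∑ t : Fin n ≃ K.erase (k : α),
        g (fun j => ⟨t j, Finset.mem_of_mem_erase (t j).2⟩) k := by
  rw [sum_equiv_fin_succ]
  exact Finset.sum_congr rfl fun k _ =>
    Fintype.sum_equiv ((Equiv.refl _).equivCongr (subtypeNeEquivErase k)) _ _ fun _ => rfl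

theorem image_castSucc_ordering {n : ℕ} (s : Fin (n + 1) ≃ K) :
    (Finset.univ.image fun j : Fin n => (s j.castSucc : α)) = K.erase (s (Fin.last n) : α) := by
  ext y
  by_cases hy : y ∈ K
  · obtain ⟨j, hj⟩ := s.surjective ⟨y, hy⟩
    obtain rfl : s j = y := congrArg Subtype.val hj
    induction j using Fin.lastCases <;> simp [Fin.castSucc_ne_last]
  · simp only [Finset.mem_image, Finset.mem_univ, true_and, Finset.mem_erase, hy, and_false,
      iff_false]
    rintro ⟨j, rfl⟩
    exact hy (s _).2

end Erase

section InOut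

variable {m : ℕ} {AI AO : Fin (m + 1) → Type*} {K : Finset (Fin (m + 1))}

/-- The equivalence underlying `split`, without the factor `H^P`. -/
def inOutEquivErase (k : K) :
    InOut AI AO K ≃ (AI k × AO k) × InOut AI AO (K.erase (k : Fin (m + 1))) :=
  (Equiv.piSplitAt k _).trans <| (Equiv.refl _).prodCongr <|
    Equiv.piCongrLeft' _ (subtypeNeEquivErase k)

theorem sum_inOut_eq_sum_split [∀ k, Fintype (AI k)] [∀ k, Fintype (AO k)] {P M : Type*}
    [AddCommMonoid M] (k : K) (p : P)
    (g : ((P × InOut AI AO (K.erase (k : Fin (m + 1)))) × AI k) × AO k → M) :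
    ∑ x : InOut AI AO K, g (split k (p, x)) =
      ∑ x : InOut AI AO (K.erase (k : Fin (m + 1))), ∑ i, ∑ o, g (((p, x), i), o) := by
  let g' (y : (AI k × AO k) × InOut AI AO (K.erase (k : Fin (m + 1)))) : M :=
    g (((p, y.2), y.1.1), y.1.2)
  rw [Fintype.sum_equiv (inOutEquivErase k) (fun x => g (split k (p, x))) g' fun _ => rfl,
    Fintype.sum_prod_type_right]
  simp only [Fintype.sum_prod_type, g']

end InOut

section TensorOut

open Matrix

variable {m : ℕ} {P R T : Type*} {AI AO : Fin (m + 1) → Type*} [∀ k, DecidableEq (AO k)]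
  {K : Finset (Fin (m + 1))}

/-- `B ⊗ 𝟙^{A_k^O}` for an operator `B : H^R → H^{P A_{K∖k}^{IO} A_k^I}` with `k ∈ K`, as an
operator `H^{A_k^O R} → H^{P A_K^{IO}}`. -/
def tensorOut (k : K) (B : Matrix ((P × InOut AI AO (K.erase (k : Fin (m + 1)))) × AI k) R ℂ) :
    Matrix (P × InOut AI AO K) (AO k × R) ℂ :=
  (B ⊗ₖ (1 : Matrix (AO k) (AO k) ℂ)).submatrix (split k) Prod.swap

variable [∀ k, Fintype (AO k)]

theorem tensorId_mul_conjTranspose [Fintype R] (k : K)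
    (B : Matrix ((P × InOut AI AO (K.erase (k : Fin (m + 1)))) × AI k) R ℂ) :
    tensorId k (B * Bᴴ) = tensorOut k B * (tensorOut k B)ᴴ := by
  rw [tensorOut, conjTranspose_submatrix,
    ← submatrix_mul _ _ (split k) _ (split k) Prod.swap_bijective, conjTranspose_kronecker,
    ← mul_kronecker_mul, conjTranspose_one, Matrix.one_mul]
  rfl

theorem tensorOut_mul_apply [Fintype R] (k : K)
    (B : Matrix ((P × InOut AI AO (K.erase (k : Fin (m + 1)))) × AI k) R ℂ)
    (V : Matrix (AO k × R) T ℂ) (q : P × InOut AI AO K) (t : T) :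
    (tensorOut k B * V) q t = ∑ b, B (split k q).1 b * V ((q.2 k).2, b) t := by
  simp [tensorOut, mul_apply, Fintype.sum_prod_type, one_apply, split]

end TensorOut

namespace Internal

open Matrix

variable {m : ℕ} {P F : Type*} {AI AO : Fin (m + 1) → Type*} (C : Internal P AI AO F)

theorem bendRight_unvec_w_zero (k : Fin (m + 1)) :
    bendRight (unvec (C.w 0 ∅ k)) = (C.first k)ᵀ.submatrix Prod.fst id := by
  have : Unique (Fin 0 ≃ (∅ : Finset (Fin (m + 1)))) :=
    { default := Equiv.equivOfIsEmpty _ _, uniq := fun _ => Equiv.ext fun j => j.elim0 }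
  ext ⟨p, x⟩ ⟨i, a⟩
  simp [bendRight, unvec, w, wSeq, choiVec]

variable [∀ k, Fintype (AO k)] [∀ k, DecidableEq (AO k)]

theorem sum_sum_wSeq_mul {T : Type*} {n : ℕ} {K : Finset (Fin (m + 1))}
    (V : ∀ k, Matrix T (AO k × Fin (C.anc (n + 1))) ℂ) (q : P × InOut AI AO K) (t : T) :
    ∑ s : Fin (n + 1) ≃ K, ∑ b,
      C.wSeq n (fun j => s j.castSucc) (fun j => q.2 (s j.castSucc)) q.1
          (s (Fin.last n)) (q.2 (s (Fin.last n))).1 b *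
        V (s (Fin.last n)) t ((q.2 (s (Fin.last n))).2, b) =
    (∑ k : K, tensorOut k (unvec (C.w n (K.erase (k : Fin (m + 1))) k)) * (V k)ᵀ) q t := by
  rw [sum_orderings_succ fun s k => ∑ b,
    C.wSeq n (fun j => s j) (fun j => q.2 (s j)) q.1 k (q.2 k).1 b * V k t ((q.2 k).2, b),
    Matrix.sum_apply]
  refine Finset.sum_congr rfl fun k _ => ?_
  rw [Finset.sum_comm, tensorOut_mul_apply]
  exact Finset.sum_congr rfl fun b _ => (Finset.sum_mul _ _ _).symm

theorem bendRight_unvec_wF :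
    bendRight (unvec C.wF) = ∑ k : (Finset.univ : Finset (Fin (m + 1))),
      tensorOut k (unvec (C.w m (Finset.univ.erase (k : Fin (m + 1))) k)) * (C.last k)ᵀ := by
  ext q t
  exact C.sum_sum_wSeq_mul C.last q t

theorem bendRight_unvec_w_succ (n : ℕ) (K : Finset (Fin (m + 1))) (k' : Fin (m + 1)) :
    bendRight (unvec (C.w (n + 1) K k')) = ∑ k : K,
      tensorOut k (unvec (C.w n (K.erase (k : Fin (m + 1))) k)) *
        (C.step (n + 1) (K.erase (k : Fin (m + 1))) k k')ᵀ := by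
  ext q t
  rw [← C.sum_sum_wSeq_mul (fun k => C.step (n + 1) (K.erase k) k k') q t]
  refine Finset.sum_congr rfl fun s _ => Finset.sum_congr rfl fun b _ => ?_
  rw [← image_castSucc_ordering]
  rfl

end Internal

section LinkExt

open Matrix

variable {m : ℕ} {P R T : Type*} {AI AO : Fin (m + 1) → Type*} [∀ k, Fintype (AI k)]
  [∀ k, Fintype (AO k)] {K : Finset (Fin (m + 1))} (A : ∀ k, Matrix (AO k) (AI k) ℂ)

/-- The link product of `⨂_{k ∈ K} |A_k⟩⟩` with a vector of `H^{P A_K^{IO} T}`, given as an operator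
`H^T → H^{P A_K^{IO}}`; the result is read as an operator `H^P → H^T`. -/
def linkExt (M : Matrix (P × InOut AI AO K) T ℂ) : Matrix T P ℂ :=
  of fun t p => ∑ x : InOut AI AO K, (∏ j : K, choiVec (A j) (x j)) * M (p, x) t

theorem linkExt_sum_mul_transpose {ι : Type*} [Fintype ι] {S : ι → Type*} [∀ i, Fintype (S i)]
    (M : ∀ i, Matrix (P × InOut AI AO K) (S i) ℂ) (V : ∀ i, Matrix T (S i) ℂ) :
    linkExt A (∑ i, M i * (V i)ᵀ) = ∑ i, V i * linkExt A (M i) := by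
  ext t p
  simp only [linkExt, of_apply, Matrix.sum_apply, mul_apply, transpose_apply, Finset.mul_sum]
  rw [Finset.sum_comm]
  refine Finset.sum_congr rfl fun i _ => ?_
  rw [Finset.sum_comm]
  refine Finset.sum_congr rfl fun s _ => Finset.sum_congr rfl fun x _ => ?_
  ring

theorem linkExt_tensorOut [∀ k, DecidableEq (AO k)] [Fintype R] [DecidableEq R] (k : K)
    (B : Matrix ((P × InOut AI AO (K.erase (k : Fin (m + 1)))) × AI k) R ℂ) :
    linkExt A (tensorOut k B) = (A k ⊗ₖ (1 : Matrix R R ℂ)) * linkExt A (bendRight B) := by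
  ext ⟨o, r⟩ p
  let g (y : ((P × InOut AI AO (K.erase (k : Fin (m + 1)))) × AI k) × AO k) : ℂ :=
    (A k y.2 y.1.2 * ∏ j : K.erase (k : Fin (m + 1)), choiVec (A j) (y.1.1.2 j)) *
      (B y.1 r * (1 : Matrix (AO k) (AO k) ℂ) y.2 o)
  calc linkExt A (tensorOut k B) (o, r) p = ∑ x : InOut AI AO K, g (split k (p, x)) :=
        Finset.sum_congr rfl fun x _ => by rw [prod_eq_mul_prod_erase k]; rfl
    _ = ∑ x : InOut AI AO (K.erase (k : Fin (m + 1))), ∑ i, A k o i *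
          ((∏ j : K.erase (k : Fin (m + 1)), choiVec (A j) (x j)) * B ((p, x), i) r) := by
        rw [sum_inOut_eq_sum_split k p g]
        simp [g, one_apply, mul_assoc]
    _ = _ := by
        rw [Finset.sum_comm]
        simp [linkExt, bendRight, mul_apply, Fintype.sum_prod_type, one_apply, Finset.mul_sum]

end LinkExt

namespace Internal

variable {m n : ℕ} {K : Finset (Fin (m + 1))}

/-- The control state `|K ∖ k, k⟩`, for `k ∈ K` and `|K| = n + 1`. -/
abbrev eraseCtl (hK : K.card = n + 1) (k : K) : Ctl m n :=
  ⟨(K.erase k, k), card_erase_coe hK k, Finset.notMem_erase _ _⟩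

theorem sum_ctl_ite_insert {M : Type*} [AddCommMonoid M] (hK : K.card = n + 1) (g : Ctl m n → M) :
    (∑ c, if K = insert c.1.2 c.1.1 then g c else 0) = ∑ k : K, g (eraseCtl hK k) := by
  rw [← Finset.sum_filter]
  symm
  refine Finset.sum_bij (fun k _ => eraseCtl hK k) ?_ ?_ ?_ fun _ _ => rfl
  · intro k _
    simp [eraseCtl, Finset.insert_erase k.2]
  · intro k _ k' _ h
    exact Subtype.ext (congrArg (fun c : Ctl m n => c.1.2) h)
  · rintro ⟨⟨K', k⟩, hc, hk⟩ h
    obtain rfl : K = insert k K' := (Finset.mem_filter.mp h).2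
    exact ⟨⟨k, Finset.mem_insert_self _ _⟩, Finset.mem_univ _,
      Subtype.ext (Prod.ext (Finset.erase_insert hk) rfl)⟩

theorem insert_ctl_eq_univ (c : Ctl m m) : insert c.1.2 c.1.1 = Finset.univ := by
  rw [← Finset.card_eq_iff_eq_univ, Finset.card_insert_of_notMem c.2.2, c.2.1, Fintype.card_fin]

open Matrix

variable {P F : Type*} {AI AO : Fin (m + 1) → Type*} (C : Internal P AI AO F)
  [∀ k, Fintype (AO k)]

theorem stepOp_mul_submatrix_sigmaMk {n : ℕ} {K : Finset (Fin (m + 1))} (hK : K.card = n + 1)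
    {k' : Fin (m + 1)} (hk' : k' ∉ K) (N : Matrix (C.Post n) P ℂ) :
    (C.stepOp n * N).submatrix (Sigma.mk ⟨(K, k'), hK, hk'⟩) id =
      ∑ k : K, C.step (n + 1) (K.erase (k : Fin (m + 1))) k k' *
        N.submatrix (Sigma.mk (eraseCtl hK k)) id := by
  rw [mul_eq_sum_submatrix_sigmaMk, ← sum_ctl_ite_insert hK fun c =>
    C.step (n + 1) c.1.1 c.1.2 k' * N.submatrix (Sigma.mk c) id]
  ext r p
  simp only [submatrix_apply, Matrix.sum_apply, id_eq]
  refine Finset.sum_congr rfl fun c _ => ?_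
  split_ifs with h <;> simp [mul_apply, stepOp, h]

theorem lastOp_mul (N : Matrix (C.Post m) P ℂ) :
    C.lastOp * N = ∑ k : (Finset.univ : Finset (Fin (m + 1))), C.last k *
      N.submatrix (Sigma.mk (eraseCtl (Finset.card_fin (m + 1)) k)) id := by
  rw [mul_eq_sum_submatrix_sigmaMk, ← sum_ctl_ite_insert (Finset.card_fin (m + 1)) fun c =>
    C.last c.1.2 * N.submatrix (Sigma.mk c) id]
  simp only [insert_ctl_eq_univ, if_true]
  rfl

variable [∀ k, Fintype (AI k)] (A : ∀ k, Matrix (AO k) (AI k) ℂ)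

theorem extOp_mul_submatrix_eraseCtl [∀ k, DecidableEq (AO k)] {n : ℕ}
    {K : Finset (Fin (m + 1))} (hK : K.card = n + 1) (k : K) {M : Matrix (C.Pre n) P ℂ}
    {B : Matrix ((P × InOut AI AO (K.erase (k : Fin (m + 1)))) × AI k) (Fin (C.anc (n + 1))) ℂ}
    (hM : M.submatrix (Sigma.mk (eraseCtl hK k)) id = linkExt A (bendRight B)) :
    (C.extOp A n * M).submatrix (Sigma.mk (eraseCtl hK k)) id = linkExt A (tensorOut k B) := by
  rw [extOp, blockDiagonal'_mul_submatrix_sigmaMk, hM, linkExt_tensorOut]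

theorem evol_submatrix_sigmaMk (n : ℕ) (c : Ctl m n) :
    (C.evol A n).submatrix (Sigma.mk c) id =
      linkExt A (bendRight (unvec (C.w n c.1.1 c.1.2))) := by
  classical
  induction n with
  | zero =>
    obtain ⟨⟨K, k⟩, hK, -⟩ := c
    obtain rfl : K = ∅ := Finset.card_eq_zero.mp hK
    ext t p
    simp [bendRight_unvec_w_zero, evol, firstOp, linkExt]
  | succ n ih =>
    obtain ⟨⟨K, k'⟩, hK, hk'⟩ := c
    rw [evol, stepOp_mul_submatrix_sigmaMk C hK hk', bendRight_unvec_w_succ,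
      linkExt_sum_mul_transpose]
    exact Finset.sum_congr rfl fun k _ =>
      congrArg _ (C.extOp_mul_submatrix_eraseCtl A hK k (ih (eraseCtl hK k)))

theorem globalOp_eq_linkExt : C.globalOp A = linkExt A (bendRight (unvec C.wF)) := by
  classical
  rw [globalOp, lastOp_mul, bendRight_unvec_wF, linkExt_sum_mul_transpose]
  exact Finset.sum_congr rfl fun k _ =>
    congrArg _ (C.extOp_mul_submatrix_eraseCtl A _ k (C.evol_submatrix_sigmaMk A m _))

theorem globalOp_apply (f : F) (a : Fin C.ancF) (p : P) :
    C.globalOp A (f, a) p =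
      ∑ x, (∏ k : (Finset.univ : Finset (Fin (m + 1))), choiVec (A k) (x k)) *
        C.wF (((p, x), f), a) := by
  rw [globalOp_eq_linkExt]
  rfl

theorem inducedChoi_eq :
    C.inducedChoi A = plug (fun k => ketbra (choiVec (A k))) (trRight (ketbra C.wF)) := by
  have hprod (a : ↥(Finset.univ : Finset (Fin (m + 1))) → ℂ) :
      ∏ k, a ⟨k, Finset.mem_univ k⟩ = ∏ k, a k :=
    (Fintype.prod_equiv (Equiv.subtypeUnivEquiv Finset.mem_univ) _ _ fun _ => rfl).symm
  have hchoi (x x' : InOut AI AO Finset.univ) :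
      ∏ k, ketbra (choiVec (A k)) (x ⟨k, Finset.mem_univ k⟩) (x' ⟨k, Finset.mem_univ k⟩) =
        (∏ k : (Finset.univ : Finset (Fin (m + 1))), choiVec (A k) (x k)) *
          star (∏ k : (Finset.univ : Finset (Fin (m + 1))), choiVec (A k) (x' k)) := by
    rw [hprod fun k => ketbra (choiVec (A k)) (x k) (x' k), star_prod, ← Finset.prod_mul_distrib]
    rfl
  ext ⟨p, f⟩ ⟨p', f'⟩
  change ∑ a, C.globalOp A (f, a) p * star (C.globalOp A (f', a) p') = _
  simp only [globalOp_apply, star_sum, star_mul', Finset.sum_mul_sum, plug, of_apply, hchoi]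
  simp only [trRight, ketbra, vecMulVec_apply, Pi.star_apply, of_apply, Finset.mul_sum]
  rw [Finset.sum_comm]
  refine Finset.sum_congr rfl fun x _ => ?_
  rw [Finset.sum_comm]
  exact Finset.sum_congr rfl fun x' _ => Finset.sum_congr rfl fun a _ =>
    mul_mul_mul_comm _ _ _ _

theorem hasProcessMatrix_iff [Finite P] [Finite F]
    {W : Matrix ((P × InOut AI AO Finset.univ) × F) ((P × InOut AI AO Finset.univ) × F) ℂ} :
    C.HasProcessMatrix W ↔ W = trRight (ketbra C.wF) := by
  constructor
  · rintro ⟨-, hW⟩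
    exact eq_of_forall_plug_ketbra_choiVec_eq fun A => by rw [← hW A, inducedChoi_eq]
  · rintro rfl
    exact ⟨(posSemidef_trRight_ketbra _).isHermitian, C.inducedChoi_eq⟩

end Internal

section Decomposition

variable {m : ℕ} {P F : Type*} {AI AO : Fin (m + 1) → Type*}

/-- The matrix `W_{(K,k)} = Tr_α |w_{(K,k)}⟩⟨w_{(K,k)}|` of a circuit. -/
def Internal.partialProcessMatrix (C : Internal P AI AO F) (K : Finset (Fin (m + 1)))
    (k : Fin (m + 1)) : Matrix ((P × InOut AI AO K) × AI k) ((P × InOut AI AO K) × AI k) ℂ :=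
  trRight (ketbra (C.w K.card K k))

theorem Internal.partialProcessMatrix_eq (C : Internal P AI AO F) {n : ℕ} {K : Finset (Fin (m + 1))}
    (hK : K.card = n) (k : Fin (m + 1)) :
    C.partialProcessMatrix K k = trRight (ketbra (C.w n K k)) := by
  rw [partialProcessMatrix, hK]

variable [DecidableEq P] [Fintype F] [∀ k, Fintype (AI k)] [∀ k, DecidableEq (AI k)]
  [∀ k, DecidableEq (AO k)]

/-- The matrices `Wd K k = W_{(K,k)}`, for `k ∉ K`, are positive semidefinite and satisfy with `W`
the linear constraints that characterise QC-QCs. The junk values `Wd K k` with `k ∈ K` are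
unconstrained. -/
structure IsQCQCDecomposition
    (W : Matrix ((P × InOut AI AO Finset.univ) × F) ((P × InOut AI AO Finset.univ) × F) ℂ)
    (Wd : ∀ K k, Matrix ((P × InOut AI AO K) × AI k) ((P × InOut AI AO K) × AI k) ℂ) : Prop where
  posSemidef : ∀ K k, k ∉ K → (Wd K k).PosSemidef
  first : ∑ k, trRight (Wd ∅ k) = 1
  step : ∀ K : Finset (Fin (m + 1)), K ≠ ∅ → K ≠ Finset.univ →
    ∑ k ∈ Kᶜ, trRight (Wd K k) =
      ∑ k : K, tensorId k (Wd (K.erase (k : Fin (m + 1))) k)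
  last : trRight W = ∑ k : (Finset.univ : Finset (Fin (m + 1))),
    tensorId k (Wd (Finset.univ.erase (k : Fin (m + 1))) k)

theorem IsQCQCDecomposition.congr
    {W : Matrix ((P × InOut AI AO Finset.univ) × F) ((P × InOut AI AO Finset.univ) × F) ℂ}
    {Wd Wd' : ∀ K k, Matrix ((P × InOut AI AO K) × AI k) ((P × InOut AI AO K) × AI k) ℂ}
    (h : IsQCQCDecomposition W Wd) (hWd : ∀ K k, k ∉ K → Wd' K k = Wd K k) :
    IsQCQCDecomposition W Wd' := by
  have herase (K : Finset (Fin (m + 1))) : ∑ k : K, tensorId k (Wd' (K.erase k) k) =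
      ∑ k : K, tensorId k (Wd (K.erase k) k) :=
    Finset.sum_congr rfl fun k _ => by rw [hWd _ _ (Finset.notMem_erase _ _)]
  refine ⟨fun K k hk => hWd K k hk ▸ h.posSemidef K k hk, ?_, fun K hK hK' => ?_, ?_⟩
  · simpa only [hWd ∅ _ (Finset.notMem_empty _)] using h.first
  · rw [herase, ← h.step K hK hK']
    exact Finset.sum_congr rfl fun k hk => by rw [hWd K k (Finset.mem_compl.mp hk)]
  · rw [herase, h.last]

theorem Internal.isTP_iff [Finite P] [∀ k, Finite (AO k)] (C : Internal P AI AO F) :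
    C.IsTP ↔ IsQCQCDecomposition (trRight (ketbra C.wF)) C.partialProcessMatrix := by
  have herase {n : ℕ} {K : Finset (Fin (m + 1))} (hK : K.card = n + 1) :
      ∑ k : K, tensorId k (C.partialProcessMatrix (K.erase k) k) =
        ∑ k : K, tensorId k (trRight (ketbra (C.w n (K.erase k) k))) :=
    Finset.sum_congr rfl fun k _ => by rw [C.partialProcessMatrix_eq (card_erase_coe hK k)]
  constructor
  · intro h
    refine ⟨fun K k _ => posSemidef_trRight_ketbra _, h.first, fun K hK hK' => ?_, ?_⟩
    · obtain ⟨n, hn⟩ := Nat.exists_eq_succ_of_ne_zero (Finset.card_ne_zero.mpr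
        (Finset.nonempty_iff_ne_empty.mpr hK))
      have hlt : K.card < m + 1 := by
        simpa using (Finset.card_lt_iff_ne_univ K).mpr hK'
      simp only [herase hn, C.partialProcessMatrix_eq hn]
      exact h.step n K (by lia) hn
    · rw [herase (Finset.card_fin (m + 1))]
      exact h.last
  · intro h
    refine ⟨h.first, fun n K hn hK => ?_, ?_⟩
    · have hne : K ≠ ∅ := by
        rintro rfl
        simp at hK
      have hne' : K ≠ Finset.univ := by
        rintro rfl
        rw [Finset.card_fin] at hK
        lia
      simpa only [herase hK, C.partialProcessMatrix_eq hK] using h.step K hne hne'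
    · rw [h.last, herase (Finset.card_fin (m + 1))]

end Decomposition

section Amplitudes

open Matrix

variable {m : ℕ} {P F : Type*} {AI AO : Fin (m + 1) → Type*} [∀ k, Fintype (AO k)]

/-- Both sides of `h` are Gram operators, of the `X j` with `Y j` as an input leg and of the
`B k ⊗ 𝟙^{A_k^O}`. -/
theorem exists_bendRight_eq_sum_tensorOut_mul [Finite P] [∀ k, Finite (AI k)]
    [∀ k, DecidableEq (AO k)] {K : Finset (Fin (m + 1))} {κ R : Type*} [Fintype R] {Y S : κ → Type*}
    [∀ j, Fintype (Y j)] [∀ j, Fintype (S j)] {s : Finset κ}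
    {B : ∀ k : K, Matrix ((P × InOut AI AO (K.erase (k : Fin (m + 1)))) × AI k) R ℂ}
    {X : ∀ j, Matrix ((P × InOut AI AO K) × Y j) (S j) ℂ}
    (h : ∑ j ∈ s, trRight (X j * (X j)ᴴ) = ∑ k, tensorId k (B k * (B k)ᴴ)) :
    ∃ V : ∀ (k : K) j, Matrix (Y j × S j) (AO k × R) ℂ,
      ∀ j ∈ s, bendRight (X j) = ∑ k, tensorOut k (B k) * (V k j)ᵀ := by
  classical
  simp only [trRight_mul_conjTranspose, tensorId_mul_conjTranspose] at h
  rw [← Finset.sum_coe_sort] at h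
  obtain ⟨V, hV⟩ := exists_eq_sum_mul_of_sum_mul_conjTranspose_eq h
  refine ⟨fun k j => if hj : j ∈ s then (V k ⟨j, hj⟩)ᵀ else 0, fun j hj => ?_⟩
  simpa only [dif_pos hj, transpose_transpose] using hV ⟨j, hj⟩

variable {d dF : ℕ} (B : ∀ K k, Matrix ((P × InOut AI AO K) × AI k) (Fin d) ℂ)
  (V : ∀ (K : Finset (Fin (m + 1))) (k : K) (k' : Fin (m + 1)),
    Matrix (AI k' × Fin d) (AO k × Fin d) ℂ)
  (VF : ∀ k : (Finset.univ : Finset (Fin (m + 1))), Matrix (F × Fin dF) (AO k × Fin d) ℂ)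

/-- The circuit with ancillas of dimension `d` whose first operations are read off `B ∅ k`, and in
which `V K k k'` leads from `B (K ∖ k) k` to `B K k'`. -/
def Internal.ofAmplitudes : Internal P AI AO F where
  anc _ := d
  ancF := dF
  first k := ((bendRight (B ∅ k)).submatrix (fun p => (p, isEmptyElim)) id)ᵀ
  step _ K k k' := V (insert k K) ⟨k, Finset.mem_insert_self k K⟩ k'
  last k := VF ⟨k, Finset.mem_univ k⟩

variable [∀ k, DecidableEq (AO k)] {B V VF}

theorem Internal.unvec_w_ofAmplitudes
    (hV : ∀ K, K ≠ ∅ → ∀ k' ∉ K, bendRight (B K k') =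
      ∑ k : K, tensorOut k (B (K.erase (k : Fin (m + 1))) k) * (V K k k')ᵀ)
    {n : ℕ} {K : Finset (Fin (m + 1))} (hK : K.card = n) {k : Fin (m + 1)} (hk : k ∉ K) :
    unvec ((ofAmplitudes B V VF).w n K k) = B K k := by
  induction n generalizing K k with
  | zero =>
    obtain rfl : K = ∅ := Finset.card_eq_zero.mp hK
    refine bendRight_injective ?_
    rw [bendRight_unvec_w_zero]
    ext ⟨p, x⟩ t
    obtain rfl : x = isEmptyElim := Subsingleton.elim _ _
    rfl
  | succ n ih =>
    have hne : K ≠ ∅ := by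
      rintro rfl
      simp at hK
    refine bendRight_injective ((bendRight_unvec_w_succ _ n K k).trans (Eq.trans ?_
      (hV K hne k hk).symm))
    refine Finset.sum_congr rfl fun j _ => ?_
    have hinsert (K' : Finset (Fin (m + 1))) (hK' : K' = K) (hj : (j : Fin (m + 1)) ∈ K') :
        V K' ⟨j, hj⟩ k = V K j k := by
      subst hK'
      rfl
    rw [ih (card_erase_coe hK j) (Finset.notMem_erase _ _),
      ← hinsert _ (Finset.insert_erase j.2) (Finset.mem_insert_self _ _)]
    rfl

theorem Internal.unvec_wF_ofAmplitudes
    (hV : ∀ K, K ≠ ∅ → ∀ k' ∉ K, bendRight (B K k') =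
      ∑ k : K, tensorOut k (B (K.erase (k : Fin (m + 1))) k) * (V K k k')ᵀ)
    {BF : Matrix ((P × InOut AI AO Finset.univ) × F) (Fin dF) ℂ}
    (hVF : bendRight BF = ∑ k : (Finset.univ : Finset (Fin (m + 1))),
      tensorOut k (B (Finset.univ.erase (k : Fin (m + 1))) k) * (VF k)ᵀ) :
    unvec (ofAmplitudes B V VF).wF = BF := by
  refine bendRight_injective ((bendRight_unvec_wF _).trans (Eq.trans ?_ hVF.symm))
  refine Finset.sum_congr rfl fun k _ => ?_
  rw [unvec_w_ofAmplitudes hV (card_erase_coe (Finset.card_fin (m + 1)) k)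
    (Finset.notMem_erase _ _)]
  rfl

end Amplitudes

section Existence

open Matrix

variable {m : ℕ} {P F : Type*} {AI AO : Fin (m + 1) → Type*} [Finite P] [Fintype F]
  [∀ k, Fintype (AI k)] [∀ k, Finite (AO k)] [∀ k, DecidableEq (AO k)]

theorem Internal.exists_partialProcessMatrix_eq {d dF : ℕ}
    {B : ∀ K k, Matrix ((P × InOut AI AO K) × AI k) (Fin d) ℂ}
    {BF : Matrix ((P × InOut AI AO Finset.univ) × F) (Fin dF) ℂ}
    (hstep : ∀ K : Finset (Fin (m + 1)), K ≠ ∅ → K ≠ Finset.univ →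
      ∑ k ∈ Kᶜ, trRight (B K k * (B K k)ᴴ) = ∑ k : K, tensorId k
        (B (K.erase (k : Fin (m + 1))) k * (B (K.erase (k : Fin (m + 1))) k)ᴴ))
    (hlast : trRight (BF * BFᴴ) = ∑ k : (Finset.univ : Finset (Fin (m + 1))), tensorId k
      (B (Finset.univ.erase (k : Fin (m + 1))) k *
        (B (Finset.univ.erase (k : Fin (m + 1))) k)ᴴ)) :
    ∃ C : Internal P AI AO F, (∀ K k, k ∉ K → C.partialProcessMatrix K k = B K k * (B K k)ᴴ) ∧
      trRight (ketbra C.wF) = BF * BFᴴ := by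
  have := fun k => Fintype.ofFinite (AO k)
  have hV (K : Finset (Fin (m + 1))) :
      ∃ V : ∀ (k : K) k', Matrix (AI k' × Fin d) (AO k × Fin d) ℂ, K ≠ ∅ → ∀ k' ∉ K,
        bendRight (B K k') =
          ∑ k : K, tensorOut k (B (K.erase (k : Fin (m + 1))) k) * (V k k')ᵀ := by
    by_cases hK : K ≠ ∅ ∧ K ≠ Finset.univ
    · obtain ⟨V, hV⟩ := exists_bendRight_eq_sum_tensorOut_mul (hstep K hK.1 hK.2)
      exact ⟨V, fun _ k' hk' => hV k' (Finset.mem_compl.mpr hk')⟩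
    · refine ⟨0, fun hne k' hk' => ?_⟩
      obtain rfl : K = Finset.univ := by tauto
      exact absurd (Finset.mem_univ k') hk'
  choose V hV using hV
  obtain ⟨VF, hVF⟩ := exists_bendRight_eq_sum_tensorOut_mul (s := {()}) (X := fun _ => BF)
    (by rwa [Finset.sum_singleton])
  refine ⟨ofAmplitudes B V fun k => VF k (), fun K k hk => ?_, ?_⟩
  · rw [partialProcessMatrix, trRight_ketbra, unvec_w_ofAmplitudes hV rfl hk]
    rfl
  · rw [trRight_ketbra, unvec_wF_ofAmplitudes hV (hVF () (Finset.mem_singleton_self _))]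
    rfl

theorem IsQCQCDecomposition.exists_internal [DecidableEq P] [∀ k, DecidableEq (AI k)]
    {W : Matrix ((P × InOut AI AO Finset.univ) × F) ((P × InOut AI AO Finset.univ) × F) ℂ}
    {Wd : ∀ K k, Matrix ((P × InOut AI AO K) × AI k) ((P × InOut AI AO K) × AI k) ℂ}
    (hW : W.PosSemidef) (h : IsQCQCDecomposition W Wd) :
    ∃ C : Internal P AI AO F, C.IsTP ∧ trRight (ketbra C.wF) = W := by
  let A (c : Finset (Fin (m + 1)) × Fin (m + 1)) :
      Matrix ((P × InOut AI AO c.1) × AI c.2) ((P × InOut AI AO c.1) × AI c.2) ℂ :=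
    if c.2 ∈ c.1 then 0 else Wd c.1 c.2
  have hA (c) : (A c).PosSemidef := by
    by_cases hc : c.2 ∈ c.1
    · simpa only [A, if_pos hc] using PosSemidef.zero
    · simpa only [A, if_neg hc] using h.posSemidef _ _ hc
  obtain ⟨d, B, hB⟩ := exists_forall_mul_conjTranspose_eq hA
  obtain ⟨dF, BF, hBF⟩ := exists_forall_mul_conjTranspose_eq fun _ : Unit => hW
  have hBd : IsQCQCDecomposition (BF () * (BF ())ᴴ) fun K k => B (K, k) * (B (K, k))ᴴ := by
    rw [hBF]
    exact h.congr fun K k hk => (hB (K, k)).trans (if_neg hk)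
  obtain ⟨C, hC, hCF⟩ := Internal.exists_partialProcessMatrix_eq hBd.step hBd.last
  refine ⟨C, C.isTP_iff.mpr ?_, hCF.trans (hBF ())⟩
  rw [hCF]
  exact hBd.congr hC

end Existence

end QCQC

theorem proposition7 {m : ℕ} {P F : Type*} {AI AO : Fin (m + 1) → Type*}
    [Fintype P] [DecidableEq P] [Fintype F] [DecidableEq F]
    [∀ k, Fintype (AI k)] [∀ k, DecidableEq (AI k)]
    [∀ k, Fintype (AO k)] [∀ k, DecidableEq (AO k)]
    (W : Matrix ((P × QCQC.InOut AI AO Finset.univ) × F)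
      ((P × QCQC.InOut AI AO Finset.univ) × F) ℂ) :
    QCQC.IsProcessMatrixOfQCQC W ↔
      W.PosSemidef ∧
      ∃ Wd : ∀ (K : Finset (Fin (m + 1))) (k : Fin (m + 1)),
          Matrix ((P × QCQC.InOut AI AO K) × AI k) ((P × QCQC.InOut AI AO K) × AI k) ℂ,
        (∀ K k, k ∉ K → (Wd K k).PosSemidef) ∧
        ∑ k, QCQC.trRight (Wd ∅ k) = 1 ∧
        (∀ K : Finset (Fin (m + 1)), K ≠ ∅ → K ≠ Finset.univ →
          ∑ k ∈ Kᶜ, QCQC.trRight (Wd K k) =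
            ∑ k : K, QCQC.tensorId k (Wd (K.erase (k : Fin (m + 1))) k)) ∧
        QCQC.trRight W =
          ∑ k : (Finset.univ : Finset (Fin (m + 1))),
            QCQC.tensorId k (Wd (Finset.univ.erase (k : Fin (m + 1))) k) := by
  constructor
  · rintro ⟨C, hTP, hW⟩
    obtain rfl := C.hasProcessMatrix_iff.mp hW
    obtain ⟨hpos, hfirst, hstep, hlast⟩ := C.isTP_iff.mp hTP
    exact ⟨QCQC.posSemidef_trRight_ketbra _, C.partialProcessMatrix, hpos, hfirst, hstep, hlast⟩
  · rintro ⟨hW, Wd, hpos, hfirst, hstep, hlast⟩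
    obtain ⟨C, hTP, hCW⟩ := QCQC.IsQCQCDecomposition.exists_internal hW
      ⟨hpos, hfirst, hstep, hlast⟩
    exact ⟨C, hTP, C.hasProcessMatrix_iff.mpr hCW.symm⟩
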